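/- Let $V$ be a finite set and let $\Gamma$ be a digraph with vertex set $V$ whose arcs carry positive real weights; write $a_{ij}>0$ for the weight of the arc $(j,i)$ from $j$ to $i$ if it is present in $\Gamma$, and $a_{ij}=0$ otherwise. The Kirchhoff matrix $L=(\ell_{ij})$ of $\Gamma$ is given by $\ell_{ij}=-a_{ij}$ for $j\ne i$ and $\ell_{ii}=\sum_{k\ne i}a_{ik}$. An out-forest of $\Gamma$ is a spanning subgraph of $\Gamma$ that is a directed forest in which every weak component is a diverging tree, i.e. has a root from which there are directed paths to all other vertices of the component. A maximum out-forest is an out-forest with the greatest number of arcs. The out-forest dimension $d$ of $\Gamma$ is the minimum possible number of weak components of an out-forest (it is attained by the maximum out-forests). The weight of a subgraph is the product of the weights of its arcs. The normalized matrix of maximum out-forests $\bar J=(\bar J_{ij})$ has as its entry $\bar J_{ij}$ the total weight of those maximum out-forests of $\Gamma$ in which $i$ belongs to a tree diverging from (i.e. rooted at) $j$, divided by the total weight of all maximum out-forests of $\Gamma$. Then: 1. $\operatorname{rank}\bar J=d$, $\ \bar J^2=\bar J$, and $L\bar J=\bar JL=0$. 2. $\bar J$ is the eigenprojection of $L$ at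 $0$, i.e. the unique idempotent matrix $Z$ whose range is the kernel of $L^{\nu}$ and whose kernel is the range of $L^{\nu}$, where $\nu$ is the index of $L$, the least $k\in\{0,1,\dots\}$ with $\operatorname{rank}L^{k+1}=\operatorname{rank}L^{k}$. 3. The linear span of the columns of $\bar J$ is the kernel $\{x\in\mathbb R^V: Lx=0\}$ of $L$, and the linear span of the rows of $\bar J$ is the left null space $\{x\in\mathbb R^V: x^{\mathsf T}L=0\}$ of $L$. -/

import Mathlib

open scoped Matrix

noncomputable section

/-- A finite digraph with nonnegative arc weights. There is an arc from `j` to `i` iff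
`a i j ≠ 0`, and then `a i j` is its weight. -/
structure WeightedDigraph (V : Type*) where
  /-- `a i j` is the weight of the arc from `j` to `i` (zero if there is no such arc). -/
  a : V → V → ℝ
  nonneg : ∀ i j, 0 ≤ a i j

/-- The undirected graph underlying the digraph on `V` with arc set `F`
(the pair `(u, v)` is the arc from `u` to `v`). -/
def underlyingGraph {V : Type*} (F : Finset (V × V)) : SimpleGraph V :=
  SimpleGraph.fromRel fun u v => (u, v) ∈ F

/-- There is a directed path (possibly of length zero) from `u` to `v` in the digraph with
arc set `F`. -/
def HasDirectedPath {V : Type*} (F : Finset (V × V)) (u v : V) : Prop :=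
  Relation.ReflTransGen (fun x y => (x, y) ∈ F) u v

/-- In the digraph with arc set `F`, the vertex `r` is a root of its weak component: there are
directed paths from `r` into all vertices of that component. -/
def IsRootOfComponent {V : Type*} (F : Finset (V × V)) (r : V) : Prop :=
  ∀ v, (underlyingGraph F).Reachable r v → HasDirectedPath F r v

/-- The spanning digraph with arc set `F` is a diverging forest: it is a directed forest
(no loops, no pairs of opposite arcs, no cycles in the underlying graph), each weak component of
which has a root. -/
structure IsDivergingForest {V : Type*} (F : Finset (V × V)) : Prop where
  /-- With `u = v` this excludes loops, with `u ≠ v` pairs of opposite arcs. -/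
  asymm : ∀ u v, (u, v) ∈ F → (v, u) ∉ F
  acyclic : (underlyingGraph F).IsAcyclic
  exists_root : ∀ C : (underlyingGraph F).ConnectedComponent,
    ∃ r, (underlyingGraph F).connectedComponentMk r = C ∧ IsRootOfComponent F r

/-- In the digraph with arc set `F`, the vertex `i` belongs to a tree diverging from `j`. -/
def BelongsToTreeFrom {V : Type*} (F : Finset (V × V)) (i j : V) : Prop :=
  IsRootOfComponent F j ∧ (underlyingGraph F).Reachable j i

/-- The number of weak components of the spanning digraph with arc set `F`. -/
def numWeakComponents {V : Type*} (F : Finset (V × V)) : ℕ :=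
  Nat.card (underlyingGraph F).ConnectedComponent

namespace WeightedDigraph

/-- The weight of a spanning subgraph with arc set `F`: the product of the weights of its arcs. -/
def weight {V : Type*} (Γ : WeightedDigraph V) (F : Finset (V × V)) : ℝ :=
  ∏ e ∈ F, Γ.a e.2 e.1

variable {V : Type*} [Fintype V]

open Classical in
/-- The arc set. -/
def arcs (Γ : WeightedDigraph V) : Finset (V × V) :=
  Finset.univ.filter fun e => Γ.a e.2 e.1 ≠ 0

open Classical in
/-- The out-forests (spanning diverging forests) of `Γ`, as arc sets. -/
def outForests (Γ : WeightedDigraph V) : Finset (Finset (V × V)) :=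
  Γ.arcs.powerset.filter fun F => IsDivergingForest F

open Classical in
/-- The maximum out-forests: those with the greatest number of arcs. -/
def maxOutForests (Γ : WeightedDigraph V) : Finset (Finset (V × V)) :=
  Γ.outForests.filter fun F => ∀ F' ∈ Γ.outForests, F'.card ≤ F.card

/-- The out-forest dimension: the minimum number of weak components (diverging trees) of an
out-forest of `Γ`. -/
def outForestDim (Γ : WeightedDigraph V) : ℕ :=
  sInf {k | ∃ F ∈ Γ.outForests, numWeakComponents F = k}

open Classical in
/-- The Kirchhoff matrix. -/
def kirchhoff (Γ : WeightedDigraph V) : Matrix V V ℝ :=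
  Matrix.of fun i j =>
    if j = i then ∑ k ∈ Finset.univ.filter (fun k => k ≠ i), Γ.a i k else -Γ.a i j

open Classical in
/-- The normalized matrix of maximum out-forests: its `(i, j)` entry is the total weight of the
maximum out-forests in which `i` belongs to a tree diverging from `j`, divided by the total
weight of all maximum out-forests. -/
def normMaxForestMatrix (Γ : WeightedDigraph V) : Matrix V V ℝ :=
  Matrix.of fun i j =>
    (∑ F ∈ Γ.maxOutForests.filter (fun F => BelongsToTreeFrom F i j), Γ.weight F) /
      ∑ F ∈ Γ.maxOutForests, Γ.weight F

end WeightedDigraph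

/-- The index of a square matrix: the least `k` with `rank (A ^ (k + 1)) = rank (A ^ k)`. -/
def matrixIndex {V : Type*} [Fintype V] [DecidableEq V] (A : Matrix V V ℝ) : ℕ :=
  sInf {k | (A ^ (k + 1)).rank = (A ^ k).rank}

/-- `Z` is an eigenprojection of `A` at the eigenvalue `0`: with `ν` the index of `A`, it is an
idempotent matrix with range the kernel of `A ^ ν` and kernel the range of `A ^ ν`. -/
structure IsEigenprojection {V : Type*} [Fintype V] [DecidableEq V]
    (A Z : Matrix V V ℝ) : Prop where
  idempotent : Z ^ 2 = Z
  range_eq : LinearMap.range Z.mulVecLin = LinearMap.ker (A ^ matrixIndex A).mulVecLin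
  ker_eq : LinearMap.ker Z.mulVecLin = LinearMap.range (A ^ matrixIndex A).mulVecLin

end

/-! Let `Q_k` be the matrix whose entry at `(i, j)` is the total weight of the out-forests with `k`
arcs in which `i` has root `j`, and let `σ_k` be the total weight of all out-forests with `k` arcs.
Everything rests on `Q_0 = σ_0 I` and the recurrence `Q_{k+1} = σ_{k+1} I - L Q_k`
(`forestMatrix_succ`), which make every `Q_k` a polynomial in `L`. If maximum out-forests have `m`
arcs, then `Q_{m+1}` and `σ_{m+1}` vanish, so `L Q_m = Q_m L = 0`; dividing the formula for `Q_m` by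
`σ_m` gives `J̄ = I - L B` with `B` commuting with `L`. These identities alone yield idempotency,
both null spaces and the eigenprojection. The rank of an idempotent is its trace, and each maximum
out-forest contributes its number of roots, `d`, to the trace.

The recurrence is the coefficient of `X^(k+1)` in the matrix forest theorem (`rootedWeight_add_sum`)
for the weights `X a_ij`. That theorem is proved without determinants: forests are encoded as parent
maps, those differing only in the parent of `i` are grouped, and each group cancels by antisymmetry
(`sum_update_eq_zero`). -/

noncomputable section

/-! ### Parent maps, their roots, and changing one parent -/

namespace ParentMap

variable {V : Type*}

/-- `u` is an ancestor of `v` (possibly `v` itself) under the parent map `p`. -/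
def Ancestor (p : V → Option V) (v u : V) : Prop :=
  Relation.ReflTransGen (fun x y => p x = some y) v u

/-- `r` is the parentless ancestor of `v`. -/
def IsRoot (p : V → Option V) (v r : V) : Prop :=
  Ancestor p v r ∧ p r = none

/-- Every vertex has a parentless ancestor. On a finite type this means that `p` has no cycles. -/
def IsForest (p : V → Option V) : Prop :=
  ∀ v, ∃ r, IsRoot p v r

theorem isRoot_self {p : V → Option V} {r v : V} (h : p r = none) : IsRoot p r v ↔ v = r := by
  refine ⟨fun hv => ?_, by rintro rfl; exact ⟨.refl, h⟩⟩
  rcases Relation.ReflTransGen.cases_head hv.1 with h1 | ⟨c, hc, -⟩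
  · exact h1.symm
  · simp [h] at hc

theorem isRoot_iff_of_parent {p : V → Option V} {v u r : V} (h : p v = some u) :
    IsRoot p v r ↔ IsRoot p u r := by
  refine ⟨fun hv => ⟨?_, hv.2⟩, fun hv => ⟨.head h hv.1, hv.2⟩⟩
  rcases Relation.ReflTransGen.cases_head hv.1 with h1 | ⟨c, hc, hcr⟩
  · subst h1
    simp [hv.2] at h
  · rw [h, Option.some_inj] at hc
    exact hc ▸ hcr

theorem isRoot_iff_of_ancestor {p : V → Option V} {v u r : V} (h : Ancestor p v u) :
    IsRoot p v r ↔ IsRoot p u r := by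
  induction h with
  | refl => rfl
  | tail _ h ih => rw [ih, isRoot_iff_of_parent h]

theorem IsRoot.unique {p : V → Option V} {v r s : V} (hr : IsRoot p v r) (hs : IsRoot p v s) :
    r = s := by
  rw [isRoot_iff_of_ancestor hr.1, isRoot_self hr.2] at hs
  exact hs.symm

/-- In a forest, ancestors of the parent of `v` are proper ancestors of `v`. -/
theorem IsForest.not_ancestor_of_parent {p : V → Option V} (hp : IsForest p) {v u : V}
    (h : p v = some u) : ¬ Ancestor p u v := by
  intro huv
  obtain ⟨r, hr, hr'⟩ := hp v
  -- On a cycle through `v`, following parents never leaves the vertices that have `v` as an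
  -- ancestor. The root `r` is then one of these, which forces `r = v`.
  have key : ∀ w, Ancestor p v w → Ancestor p w v := by
    intro w hw
    induction hw with
    | refl => exact .refl
    | @tail b c _ hbc ih =>
      rcases Relation.ReflTransGen.cases_head ih with h1 | ⟨d, hd, hdv⟩
      · subst h1
        rw [h, Option.some_inj] at hbc
        exact hbc ▸ huv
      · rw [hbc, Option.some_inj] at hd
        exact hd ▸ hdv
  have := (isRoot_self hr').1 ⟨key r hr, by
    rcases Relation.ReflTransGen.cases_head (key r hr) with h1 | ⟨d, hd, -⟩
    · exact h1 ▸ hr'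
    · simp [hr'] at hd⟩
  simp [this, hr'] at h

section Update

variable [DecidableEq V] {p : V → Option V} {i q : V}

/-- The chain of parents from `v` never meets `i`, so the change at `i` does not affect it. -/
theorem isRoot_update_of_not_ancestor {v r : V} (hv : ¬ Ancestor p v i)
    (o : Option V) : IsRoot p v r → IsRoot (Function.update p i o) v r := by
  rintro ⟨h, hr⟩
  have hri : r ≠ i := fun e => hv (e ▸ h)
  refine ⟨?_, by rwa [Function.update_of_ne hri]⟩
  clear hr hri
  induction h using Relation.ReflTransGen.head_induction_on with
  | refl => exact .refl
  | @head a c hac _ ih =>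
    have hai : a ≠ i := fun e => hv (e ▸ .refl)
    refine .head (by rwa [Function.update_of_ne hai]) (ih fun hc => hv (.head hac hc))

theorem ancestor_update {v : V} (hv : Ancestor p v i) (o : Option V) :
    Ancestor (Function.update p i o) v i := by
  induction hv using Relation.ReflTransGen.head_induction_on with
  | refl => exact .refl
  | @head a c hac _ ih =>
    by_cases hai : a = i
    · exact hai ▸ .refl
    · exact .head (by rwa [Function.update_of_ne hai]) ih

theorem IsForest.update_none (hp : IsForest p) : IsForest (Function.update p i none) := by
  intro v
  by_cases hv : Ancestor p v i
  · exact ⟨i, ancestor_update hv _, by simp⟩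
  · obtain ⟨r, hr⟩ := hp v
    exact ⟨r, isRoot_update_of_not_ancestor hv _ hr⟩

/-- Root of a vertex after a root `i` is attached to a vertex `q` of another tree. -/
theorem isRoot_update_some (hp : IsForest p) (hq : ¬ Ancestor p q i) {v j : V} :
    IsRoot (Function.update p i (some q)) v j ↔
      (Ancestor p v i ∧ IsRoot p q j) ∨ (¬ Ancestor p v i ∧ IsRoot p v j) := by
  have aux : ∀ {w}, ¬ Ancestor p w i →
      (IsRoot (Function.update p i (some q)) w j ↔ IsRoot p w j) := by
    intro w hw
    obtain ⟨r, hr⟩ := hp w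
    have hr' := isRoot_update_of_not_ancestor hw (some q) hr
    exact ⟨fun h => hr'.unique h ▸ hr, fun h => isRoot_update_of_not_ancestor hw (some q) h⟩
  by_cases hv : Ancestor p v i
  · rw [isRoot_iff_of_ancestor (ancestor_update hv (some q)),
      isRoot_iff_of_parent (Function.update_self i (some q) p), aux hq]
    simp [hv]
  · simp [hv, aux hv]

/-- Attaching the root `i` to `q` closes a cycle exactly when `q` already lies in the tree of `i`.
-/
theorem isForest_update_some_iff (hi : p i = none) :
    IsForest (Function.update p i (some q)) ↔ IsForest p ∧ ¬ Ancestor p q i := by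
  constructor
  · intro h
    have hpi : p = Function.update (Function.update p i (some q)) i none := by
      simp [← hi]
    refine ⟨hpi ▸ h.update_none, fun hq => ?_⟩
    exact h.not_ancestor_of_parent (Function.update_self i (some q) p) (ancestor_update hq _)
  · rintro ⟨hp, hq⟩ v
    by_cases hv : Ancestor p v i
    · obtain ⟨r, hr⟩ := hp q
      exact ⟨r, (isRoot_update_some hp hq).2 (.inl ⟨hv, hr⟩)⟩
    · obtain ⟨r, hr⟩ := hp v
      exact ⟨r, (isRoot_update_some hp hq).2 (.inr ⟨hv, hr⟩)⟩

end Update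

/-! ### The matrix forest theorem over a commutative ring -/

section Weight

variable {R : Type*} [CommRing R]

open Classical in
/-- The indicator of `j` being the root of `v`. -/
def rootIndicator (R : Type*) [CommRing R] (p : V → Option V) (v j : V) : R :=
  if IsRoot p v j then 1 else 0

theorem rootIndicator_of_isRoot {p : V → Option V} {v j : V} (h : IsRoot p v j) :
    rootIndicator R p v j = 1 :=
  if_pos h

theorem rootIndicator_of_not_isRoot {p : V → Option V} {v j : V} (h : ¬ IsRoot p v j) :
    rootIndicator R p v j = 0 :=
  if_neg h

theorem isRoot_iff_ancestor {p : V → Option V} {i : V} (hi : p i = none) (v : V) : IsRoot p v i ↔ Ancestor p v i :=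
  ⟨fun h => h.1, fun h => ⟨h, hi⟩⟩

theorem rootIndicator_self [DecidableEq V] {p : V → Option V} {i : V} (hi : p i = none) (j : V) :
    rootIndicator R p i j = if i = j then 1 else 0 := by
  by_cases h : i = j
  · rw [rootIndicator_of_isRoot ((isRoot_self hi).2 h.symm), if_pos h]
  · rw [rootIndicator_of_not_isRoot fun h' => h ((isRoot_self hi).1 h').symm, if_neg h]

/-- Grafting the tree of `i` onto that of `q`, phrased as a polynomial identity in indicators so
that the later cancellation is ring arithmetic. -/
theorem rootIndicator_update_some [DecidableEq V] {p : V → Option V} {i : V} (hp : IsForest p) (hi : p i = none) {q : V}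
    (hq : ¬ Ancestor p q i) (v j : V) :
    rootIndicator R (Function.update p i (some q)) v j =
      rootIndicator R p v i * rootIndicator R p q j +
        (1 - rootIndicator R p v i) * rootIndicator R p v j := by
  by_cases h : Ancestor p v i
  · rw [rootIndicator_of_isRoot ((isRoot_iff_ancestor hi v).2 h)]
    have : IsRoot (Function.update p i (some q)) v j ↔ IsRoot p q j := by
      simp [isRoot_update_some hp hq, h]
    by_cases h' : IsRoot p q j
    · rw [rootIndicator_of_isRoot h', rootIndicator_of_isRoot (this.2 h')]
      ring
    · rw [rootIndicator_of_not_isRoot h', rootIndicator_of_not_isRoot (h' ∘ this.1)]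
      ring
  · rw [rootIndicator_of_not_isRoot (h ∘ (isRoot_iff_ancestor hi v).1)]
    have : IsRoot (Function.update p i (some q)) v j ↔ IsRoot p v j := by
      simp [isRoot_update_some hp hq, h]
    by_cases h' : IsRoot p v j
    · rw [rootIndicator_of_isRoot h', rootIndicator_of_isRoot (this.2 h')]
      ring
    · rw [rootIndicator_of_not_isRoot h', rootIndicator_of_not_isRoot (h' ∘ this.1)]
      ring

variable [Fintype V]

/-- The summand changes sign when `q` and `l` are exchanged. -/
theorem sum_sum_antisymm (f : V → R) (g : V → R) :
    ∑ q, f q * ∑ l, f l * (g q - g l) = 0 := by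
  simp only [mul_sub, Finset.sum_sub_distrib, Finset.mul_sum]
  rw [sub_eq_zero, Finset.sum_comm]
  exact Finset.sum_congr rfl fun q _ => Finset.sum_congr rfl fun l _ => by ring

/-- The product of the weights of the arcs of a parent map. -/
def weight (a : V → V → R) (p : V → Option V) : R :=
  ∏ v, (p v).elim 1 (a v)

open Classical in
/-- The weight of a forest, and zero for a parent map that is not a forest. -/
def forestWeight (a : V → V → R) (p : V → Option V) : R :=
  if IsForest p then weight a p else 0

/-- The total weight of all forests. -/
def totalWeight (a : V → V → R) : R :=
  ∑ᶠ p : V → Option V, forestWeight a p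

/-- The total weight of the forests in which `i` has root `j`. -/
def rootedWeight (a : V → V → R) (i j : V) : R :=
  ∑ᶠ p : V → Option V, forestWeight a p * rootIndicator R p i j

variable [DecidableEq V] (a : V → V → R) {p : V → Option V} {i : V}

theorem weight_update_some (hi : p i = none) (q : V) :
    weight a (Function.update p i (some q)) = a i q * weight a p := by
  unfold weight
  rw [← Finset.mul_prod_erase _ _ (Finset.mem_univ i),
    ← Finset.mul_prod_erase _ (fun v => (p v).elim 1 (a v)) (Finset.mem_univ i)]
  simp only [Function.update_self, hi, Option.elim, one_mul]
  congr 1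
  refine Finset.prod_congr rfl fun v hv => ?_
  rw [Function.update_of_ne (Finset.ne_of_mem_erase hv)]

/-- The factor `1 - rootIndicator R p q i` kills the attachments that would close a cycle. -/
theorem forestWeight_update_some (hi : p i = none) (q : V) :
    forestWeight a (Function.update p i (some q)) =
      forestWeight a p * ((1 - rootIndicator R p q i) * a i q) := by
  have h := isForest_update_some_iff (q := q) hi
  rw [← isRoot_iff_ancestor hi] at h
  by_cases hp : IsForest p <;> by_cases hq : IsRoot p q i
  · simp [forestWeight, h, hp, hq, rootIndicator_of_isRoot hq]
  · simp [forestWeight, h, hp, hq, rootIndicator_of_not_isRoot hq, weight_update_some a hi,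
      mul_comm]
  all_goals simp [forestWeight, h, hp]

theorem sum_eq_sum_update {M : Type*} [AddCommMonoid M] (i : V) (f : (V → Option V) → M) :
    ∑ p, f p = ∑ p with p i = none, ∑ o, f (Function.update p i o) := by
  rw [← Finset.sum_product']
  refine Finset.sum_nbij' (fun p => (Function.update p i none, p i))
    (fun x => Function.update x.1 i x.2) ?_ ?_ ?_ ?_ ?_
  · simp
  · simp
  · simp
  · rintro ⟨p, o⟩ h
    simp only [Finset.mem_product, Finset.mem_filter, Finset.mem_univ, true_and, and_true] at h
    simp [← h]
  · simp

/-- Cancellation among the forests that differ only in the parent of `i`. -/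
theorem sum_update_eq_zero (hi : p i = none) (j : V) :
    ∑ o, forestWeight a (Function.update p i o) *
      (rootIndicator R (Function.update p i o) i j +
        ∑ l, a i l * (rootIndicator R (Function.update p i o) i j -
          rootIndicator R (Function.update p i o) l j) - if i = j then 1 else 0) = 0 := by
  by_cases hp : IsForest p
  swap
  · have h0 : forestWeight a p = 0 := by simp [forestWeight, hp]
    have hn : Function.update p i none = p := by rw [← hi, Function.update_eq_self]
    simp [Fintype.sum_option, forestWeight_update_some a hi, hn, h0]
  have hn : Function.update p i none = p := by rw [← hi, Function.update_eq_self]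
  rw [Fintype.sum_option, hn]
  set χ : V → R := fun v => rootIndicator R p v i with hχ
  set ρ : V → R := fun v => rootIndicator R p v j with hρ
  set δ : R := if i = j then 1 else 0 with hδ
  have hρi : ρ i = δ := rootIndicator_self hi j
  have hχi : χ i = 1 := by simp [hχ, rootIndicator_self hi]
  -- Inside the tree of `i` the root is `i`, so `ρ v = δ`; outside it the factor is `1`.
  have hχρ : ∀ v, (1 - χ v) * (ρ v - δ) = ρ v - δ := by
    intro v
    by_cases hv : IsRoot p v i
    · have : ρ v = δ := by
        by_cases hj : i = j
        · rw [hδ, if_pos hj]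
          exact rootIndicator_of_isRoot (hj ▸ hv)
        · rw [hδ, if_neg hj]
          exact rootIndicator_of_not_isRoot fun h => hj (hv.unique h)
      simp [this]
    · simp [hχ, rootIndicator, hv]
  -- After attachment, `i` and every `l` of its old tree share a root, whence the factor `1 - χ l`.
  -- The second summand is antisymmetric and sums to zero; the first will cancel the term where `i`
  -- stays a root.
  have hsome : ∀ q, forestWeight a (Function.update p i (some q)) *
      (rootIndicator R (Function.update p i (some q)) i j +
        ∑ l, a i l * (rootIndicator R (Function.update p i (some q)) i j -
          rootIndicator R (Function.update p i (some q)) l j) - δ) =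
      forestWeight a p * (a i q * (ρ q - δ)) + forestWeight a p * (((1 - χ q) * a i q) *
        ∑ l, ((1 - χ l) * a i l) * (ρ q - ρ l)) := by
    intro q
    rw [forestWeight_update_some a hi]
    by_cases hq : Ancestor p q i
    · have h1 : χ q = 1 := by simp [hχ, rootIndicator, isRoot_iff_ancestor hi, hq]
      have h2 := hχρ q
      rw [h1] at h2
      have h3 : ρ q - δ = 0 := by rw [← h2]; ring
      change forestWeight a p * ((1 - χ q) * _) * _ = _
      rw [h1, h3]
      ring
    · simp only [rootIndicator_update_some hp hi hq]
      change forestWeight a p * ((1 - χ q) * _) * ((χ i * ρ q + (1 - χ i) * ρ i) +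
        ∑ l, a i l * ((χ i * ρ q + (1 - χ i) * ρ i) - (χ l * ρ q + (1 - χ l) * ρ l)) - δ) = _
      have h1 : ∑ l, a i l * ((χ i * ρ q + (1 - χ i) * ρ i) - (χ l * ρ q + (1 - χ l) * ρ l)) =
          ∑ l, ((1 - χ l) * a i l) * (ρ q - ρ l) :=
        Finset.sum_congr rfl fun l _ => by rw [hχi]; ring
      rw [h1, hχi, ← hχρ q]
      ring
  rw [Finset.sum_congr rfl fun q _ => hsome q, Finset.sum_add_distrib, ← Finset.mul_sum,
    ← Finset.mul_sum, sum_sum_antisymm]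
  change forestWeight a p * (ρ i + ∑ l, a i l * (ρ i - ρ l) - δ) + _ = 0
  rw [hρi]
  have : ∑ l, a i l * (δ - ρ l) = - ∑ q, a i q * (ρ q - δ) := by
    rw [← Finset.sum_neg_distrib]
    exact Finset.sum_congr rfl fun l _ => by ring
  rw [this]
  ring

/-- The matrix forest theorem: the identity plus the Kirchhoff matrix, times the matrix of rooted
forest weights, is the total weight of forests times the identity. -/
theorem rootedWeight_add_sum (i j : V) :
    rootedWeight a i j + ∑ l, a i l * (rootedWeight a i j - rootedWeight a l j) =
      if i = j then totalWeight a else 0 := by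
  simp only [rootedWeight, totalWeight, finsum_eq_sum_of_fintype]
  have h := sum_eq_sum_update i fun p : V → Option V => forestWeight a p *
    (rootIndicator R p i j + ∑ l, a i l * (rootIndicator R p i j - rootIndicator R p l j) -
      if i = j then 1 else 0)
  rw [Finset.sum_eq_zero (s := Finset.univ.filter fun p : V → Option V => p i = none)
    fun p hp => sum_update_eq_zero a (Finset.mem_filter.1 hp).2 j] at h
  simp only [mul_sub, mul_add, Finset.sum_sub_distrib, Finset.sum_add_distrib, Finset.mul_sum] at h ⊢
  rw [sub_eq_zero] at h
  convert h using 1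
  · congr 2
    · rw [Finset.sum_comm]
      exact Finset.sum_congr rfl fun q _ => Finset.sum_congr rfl fun l _ => by ring
    · rw [Finset.sum_comm]
      exact Finset.sum_congr rfl fun q _ => Finset.sum_congr rfl fun l _ => by ring
  · split_ifs <;> simp

end Weight

end ParentMap

/-! ### Incoming arcs in a diverging forest -/

section UnderlyingGraph

variable {V : Type*} {F : Finset (V × V)}

theorem underlyingGraph_adj {u v : V} :
    (underlyingGraph F).Adj u v ↔ u ≠ v ∧ ((u, v) ∈ F ∨ (v, u) ∈ F) :=
  SimpleGraph.fromRel_adj _ _ _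

namespace IsDivergingForest

theorem ne (hF : IsDivergingForest F) {u v : V} (h : (u, v) ∈ F) : u ≠ v := by
  rintro rfl
  exact hF.asymm _ _ h h

theorem adj (hF : IsDivergingForest F) {u v : V} (h : (u, v) ∈ F) :
    (underlyingGraph F).Adj u v :=
  underlyingGraph_adj.2 ⟨hF.ne h, .inl h⟩

/-- Removing the arc `(u, v)` separates the head `v` from every vertex with a directed path
to `u`. -/
theorem not_reachable_deleteEdges (hF : IsDivergingForest F) {u v r : V} (h : (u, v) ∈ F)
    (hr : HasDirectedPath F r u) :
    ¬ ((underlyingGraph F).deleteEdges {s(u, v)}).Reachable r v := by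
  have hb : ¬ ((underlyingGraph F).deleteEdges {s(u, v)}).Reachable u v :=
    SimpleGraph.isAcyclic_iff_forall_adj_isBridge.1 hF.acyclic (hF.adj h)
  induction hr using Relation.ReflTransGen.head_induction_on with
  | refl => exact hb
  | @head x y hxy _ ih =>
    intro hx
    -- Any arc of the path other than `(u, v)` survives the deletion, so reachability passes from
    -- `x` to `y`; the reversed arc is excluded by `asymm`.
    by_cases hxv : s(x, y) = s(u, v)
    · rcases Sym2.eq_iff.1 hxv with ⟨rfl, rfl⟩ | ⟨rfl, rfl⟩
      · exact hb hx
      · exact hF.asymm _ _ h hxy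
    · refine ih (SimpleGraph.Reachable.trans (SimpleGraph.Adj.reachable ?_) hx)
      rw [SimpleGraph.deleteEdges_adj]
      exact ⟨(hF.adj hxy).symm, by rwa [Set.mem_singleton_iff, Sym2.eq_swap]⟩

theorem not_hasDirectedPath (hF : IsDivergingForest F) {u v : V} (h : (u, v) ∈ F) :
    ¬ HasDirectedPath F v u :=
  fun h' => hF.not_reachable_deleteEdges h h' .rfl

theorem exists_isRootOfComponent (hF : IsDivergingForest F) (v : V) :
    ∃ r, IsRootOfComponent F r ∧ HasDirectedPath F r v := by
  obtain ⟨r, hr, hr'⟩ := hF.exists_root ((underlyingGraph F).connectedComponentMk v)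
  exact ⟨r, hr', hr' v (SimpleGraph.ConnectedComponent.exact hr)⟩

theorem notMem_of_isRootOfComponent (hF : IsDivergingForest F) {r u : V}
    (hr : IsRootOfComponent F r) : (u, r) ∉ F :=
  fun h => hF.not_hasDirectedPath h (hr u (hF.adj h).symm.reachable)

/-- A vertex of a diverging forest has at most one incoming arc. -/
theorem parent_unique (hF : IsDivergingForest F) {u u' v : V} (h : (u, v) ∈ F)
    (h' : (u', v) ∈ F) : u = u' := by
  by_contra hne
  obtain ⟨r, hr, hrv⟩ := hF.exists_isRootOfComponent v
  have hadj : ∀ {w w'}, w ≠ w' → (w, v) ∈ F →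
      ((underlyingGraph F).deleteEdges {s(w', v)}).Reachable w v := by
    intro w w' hw hwv
    refine SimpleGraph.Adj.reachable ?_
    rw [SimpleGraph.deleteEdges_adj]
    exact ⟨hF.adj hwv, fun e => hw (Sym2.congr_left.1 e)⟩
  have aux : ∀ {w}, (w, v) ∈ F → ¬ ((underlyingGraph F).deleteEdges {s(w, v)}).Reachable r v :=
    fun hw => hF.not_reachable_deleteEdges hw
      (hr _ ((SimpleGraph.Reachable.trans
        (Relation.ReflTransGen.head_induction_on (motive := fun x _ =>
          (underlyingGraph F).Reachable x v) hrv .rfl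
          fun hxy _ ih => (hF.adj hxy).reachable.trans ih) (hF.adj hw).symm.reachable)))
  -- The root reaches both tails `u` and `u'`, so by `aux` deleting either arc separates it from
  -- `v`. Yet a directed path to `v` can avoid one of the two edges: if it meets one, the other is
  -- not needed from there on.
  have key : ∀ x, HasDirectedPath F x v →
      ((underlyingGraph F).deleteEdges {s(u, v)}).Reachable x v ∨
      ((underlyingGraph F).deleteEdges {s(u', v)}).Reachable x v := by
    intro x hx
    induction hx using Relation.ReflTransGen.head_induction_on with
    | refl => exact .inl .rfl
    | @head x y hxy _ ih =>
      have step : ∀ {w w'}, w ≠ w' → (w, v) ∈ F →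
          ((underlyingGraph F).deleteEdges {s(w, v)}).Reachable y v →
          ((underlyingGraph F).deleteEdges {s(w, v)}).Reachable x v ∨
          ((underlyingGraph F).deleteEdges {s(w', v)}).Reachable x v := by
        intro w w' hw hwv hy
        by_cases hxv : s(x, y) = s(w, v)
        · rcases Sym2.eq_iff.1 hxv with ⟨rfl, rfl⟩ | ⟨rfl, rfl⟩
          · exact .inr (hadj hw hwv)
          · exact (hF.asymm _ _ hwv hxy).elim
        · refine .inl (SimpleGraph.Reachable.trans (SimpleGraph.Adj.reachable ?_) hy)
          rw [SimpleGraph.deleteEdges_adj]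
          exact ⟨hF.adj hxy, hxv⟩
      rcases ih with ih | ih
      · exact step hne h ih
      · exact (step (Ne.symm hne) h' ih).symm
  exact (key r hrv).elim (aux h) (aux h')

end IsDivergingForest

end UnderlyingGraph

/-! ### Diverging forests correspond to acyclic parent maps -/

namespace ParentMap

variable {V : Type*} [Fintype V]

open Classical in
/-- The arcs of a parent map, directed from parents to children. -/
def arcSet (p : V → Option V) : Finset (V × V) :=
  Finset.univ.filter fun e => p e.2 = some e.1

theorem mem_arcSet {p : V → Option V} {u v : V} : (u, v) ∈ arcSet p ↔ p v = some u := by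
  simp [arcSet]

theorem arcSet_injective : Function.Injective (arcSet (V := V)) := by
  intro p q h
  funext v
  ext u
  simpa [mem_arcSet] using congrArg ((u, v) ∈ ·) h

theorem hasDirectedPath_arcSet {p : V → Option V} {u v : V} :
    HasDirectedPath (arcSet p) u v ↔ Ancestor p v u := by
  unfold HasDirectedPath Ancestor
  rw [← Relation.reflTransGen_swap]
  simp only [mem_arcSet]

theorem isRoot_iff_of_reachable {p : V → Option V} {u v : V}
    (h : (underlyingGraph (arcSet p)).Reachable u v) (r : V) : IsRoot p u r ↔ IsRoot p v r := by
  rw [SimpleGraph.reachable_iff_reflTransGen] at h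
  induction h with
  | refl => rfl
  | tail _ h ih =>
    rw [ih]
    rcases (underlyingGraph_adj.1 h).2 with h | h <;> rw [mem_arcSet] at h
    · exact (isRoot_iff_of_parent h).symm
    · exact isRoot_iff_of_parent h

variable {p : V → Option V}

theorem IsForest.reachable_iff (hp : IsForest p) {u v : V} :
    (underlyingGraph (arcSet p)).Reachable u v ↔ ∃ r, IsRoot p u r ∧ IsRoot p v r := by
  constructor
  · intro h
    obtain ⟨r, hr⟩ := hp u
    exact ⟨r, hr, (isRoot_iff_of_reachable h r).1 hr⟩
  · have key : ∀ {w r}, Ancestor p w r → (underlyingGraph (arcSet p)).Reachable w r := by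
      intro w r h
      induction h with
      | refl => exact .rfl
      | @tail b c _ hbc ih =>
        by_cases hne : b = c
        · exact hne ▸ ih
        · exact ih.trans
            (SimpleGraph.Adj.reachable (underlyingGraph_adj.2 ⟨hne, .inr (mem_arcSet.2 hbc)⟩))
    rintro ⟨r, hu, hv⟩
    exact (key hu.1).trans (key hv.1).symm

theorem IsForest.isRootOfComponent_iff (hp : IsForest p) {r : V} :
    IsRootOfComponent (arcSet p) r ↔ p r = none := by
  constructor
  · intro h
    by_contra hne
    obtain ⟨u, hu⟩ := Option.ne_none_iff_exists'.1 hne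
    refine hp.not_ancestor_of_parent hu (hasDirectedPath_arcSet.1 (h u ?_))
    obtain ⟨s, hs⟩ := hp u
    exact hp.reachable_iff.2 ⟨s, (isRoot_iff_of_parent hu).2 hs, hs⟩
  · intro h v hv
    rw [hasDirectedPath_arcSet]
    exact ((isRoot_iff_of_reachable hv r).1 ((isRoot_self h).2 rfl)).1

theorem IsForest.belongsToTreeFrom_iff (hp : IsForest p) {i j : V} :
    BelongsToTreeFrom (arcSet p) i j ↔ IsRoot p i j := by
  rw [BelongsToTreeFrom, hp.isRootOfComponent_iff]
  constructor
  · rintro ⟨h, hr⟩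
    exact (isRoot_iff_of_reachable hr j).1 ((isRoot_self h).2 rfl)
  · intro h
    exact ⟨h.2, hp.reachable_iff.2 ⟨j, (isRoot_self h.2).2 rfl, h⟩⟩

theorem IsForest.isDivergingForest (hp : IsForest p) : IsDivergingForest (arcSet p) where
  asymm u v h h' := by
    rw [mem_arcSet] at h h'
    exact hp.not_ancestor_of_parent h (.single h')
  acyclic := by
    -- The only edge leaving the set of descendants of `v` joins `v` to its parent `u`. Once it is
    -- deleted, everything reachable from `v` is a descendant of `v`, which `u` is not.
    have key : ∀ {u v}, p v = some u →
        ¬ ((underlyingGraph (arcSet p)).deleteEdges {s(u, v)}).Reachable v u := by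
      intro u v h hr
      refine hp.not_ancestor_of_parent h ?_
      rw [SimpleGraph.reachable_iff_reflTransGen] at hr
      have : ∀ w, Relation.ReflTransGen
          ((underlyingGraph (arcSet p)).deleteEdges {s(u, v)}).Adj v w → Ancestor p w v := by
        intro w hw
        induction hw with
        | refl => exact .refl
        | @tail b c _ hbc ih =>
          rw [SimpleGraph.deleteEdges_adj, underlyingGraph_adj, mem_arcSet, mem_arcSet] at hbc
          obtain ⟨⟨-, hbc | hcb⟩, hne⟩ := hbc
          · exact .head hbc ih
          · rcases Relation.ReflTransGen.cases_head ih with rfl | ⟨d, hd, hdv⟩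
            · rw [h, Option.some_inj] at hcb
              simp [hcb, Sym2.eq_swap] at hne
            · rw [hcb, Option.some_inj] at hd
              exact hd ▸ hdv
      exact this u hr
    rw [SimpleGraph.isAcyclic_iff_forall_adj_isBridge]
    intro u v h
    rw [SimpleGraph.isBridge_iff]
    rcases (underlyingGraph_adj.1 h).2 with h | h <;> rw [mem_arcSet] at h
    · exact fun h' => key h h'.symm
    · rw [Sym2.eq_swap]
      exact key h
  exists_root C := by
    obtain ⟨v, rfl⟩ := C.exists_rep
    obtain ⟨r, hr⟩ := hp v
    exact ⟨r, SimpleGraph.ConnectedComponent.sound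
      (hp.reachable_iff.2 ⟨r, (isRoot_self hr.2).2 rfl, hr⟩), hp.isRootOfComponent_iff.2 hr.2⟩

/-- Diverging forests are the arc sets of forests given by parent maps. -/
theorem exists_isForest_of_isDivergingForest {F : Finset (V × V)} (hF : IsDivergingForest F) :
    ∃ p : V → Option V, IsForest p ∧ arcSet p = F := by
  classical
  let p : V → Option V := fun v => if h : ∃ u, (u, v) ∈ F then some h.choose else none
  have hp : ∀ u v, p v = some u ↔ (u, v) ∈ F := by
    intro u v
    by_cases h : ∃ u, (u, v) ∈ F
    · simp only [p, dif_pos h, Option.some_inj]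
      exact ⟨fun e => e ▸ h.choose_spec, fun e => hF.parent_unique h.choose_spec e⟩
    · simp only [p, dif_neg h, reduceCtorEq, false_iff]
      exact fun e => h ⟨u, e⟩
  have hpF : arcSet p = F := by
    ext ⟨u, v⟩
    rw [mem_arcSet, hp]
  refine ⟨p, fun v => ?_, hpF⟩
  obtain ⟨r, hr, hrv⟩ := hF.exists_isRootOfComponent v
  refine ⟨r, ?_, ?_⟩
  · rw [← hasDirectedPath_arcSet, hpF]
    exact hrv
  · by_contra hne
    obtain ⟨u, hu⟩ := Option.ne_none_iff_exists'.1 hne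
    exact hF.notMem_of_isRootOfComponent hr ((hp u r).1 hu)

theorem isDivergingForest_arcSet_iff : IsDivergingForest (arcSet p) ↔ IsForest p := by
  refine ⟨fun h => ?_, IsForest.isDivergingForest⟩
  obtain ⟨q, hq, hqp⟩ := exists_isForest_of_isDivergingForest h
  exact arcSet_injective hqp ▸ hq

theorem prod_arcSet {M : Type*} [CommMonoid M] (p : V → Option V) (f : V × V → M) :
    ∏ e ∈ arcSet p, f e = ∏ v, (p v).elim 1 fun u => f (u, v) := by
  classical
  rw [arcSet, Finset.prod_filter, ← Finset.univ_product_univ, Finset.prod_product_right]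
  refine Finset.prod_congr rfl fun v _ => ?_
  rcases h : p v with - | u
  · simp [h]
  · rw [Finset.prod_eq_single u] <;> simp +contextual [h, eq_comm]

/-- Arcs correspond to their heads, which are the vertices with a parent. -/
theorem card_arcSet_add_card_roots [DecidableEq V] (p : V → Option V) :
    (arcSet p).card + (Finset.univ.filter fun v => p v = none).card = Fintype.card V := by
  have h : (arcSet p).card = (Finset.univ.filter fun v => ¬ p v = none).card := by
    refine Finset.card_nbij' (fun e => e.2) (fun v => ((p v).getD v, v)) ?_ ?_ ?_ ?_
    · rintro ⟨u, v⟩ h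
      simp_all [mem_arcSet]
    · intro v h
      obtain ⟨u, hu⟩ := Option.ne_none_iff_exists'.1 (Finset.mem_filter.1 h).2
      simp [mem_arcSet, hu]
    · rintro ⟨u, v⟩ h
      simp_all [mem_arcSet]
    · intro v h
      rfl
  rw [h, add_comm, Finset.card_filter_add_card_filter_not, Finset.card_univ]

theorem IsForest.numWeakComponents_eq [DecidableEq V] (hp : IsForest p) :
    numWeakComponents (arcSet p) = (Finset.univ.filter fun v => p v = none).card := by
  have e : {v // p v = none} ≃ (underlyingGraph (arcSet p)).ConnectedComponent := by
    refine Equiv.ofBijective (fun v => (underlyingGraph (arcSet p)).connectedComponentMk v) ⟨?_, ?_⟩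
    · rintro ⟨u, hu⟩ ⟨v, hv⟩ h
      obtain ⟨r, hr, hr'⟩ := hp.reachable_iff.1 (SimpleGraph.ConnectedComponent.exact h)
      exact Subtype.ext (((isRoot_self hu).2 rfl).unique
        ((isRoot_iff_of_reachable (SimpleGraph.ConnectedComponent.exact h) v).2
          ((isRoot_self hv).2 rfl)))
    · intro C
      obtain ⟨v, rfl⟩ := C.exists_rep
      obtain ⟨r, hr⟩ := hp v
      exact ⟨⟨r, hr.2⟩, SimpleGraph.ConnectedComponent.sound
        (hp.reachable_iff.2 ⟨r, (isRoot_self hr.2).2 rfl, hr⟩)⟩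
  rw [numWeakComponents, ← Nat.card_congr e, Nat.card_eq_fintype_card, Fintype.card_subtype]

end ParentMap

/-! ### Linear algebra of idempotents and eigenprojections -/

section Eigenprojection

theorem rank_eq_rank_of_ker_eq {V : Type*} [Fintype V] {A B : Matrix V V ℝ}
    (h : LinearMap.ker A.mulVecLin = LinearMap.ker B.mulVecLin) : A.rank = B.rank := by
  have h1 := LinearMap.finrank_range_add_finrank_ker A.mulVecLin
  have h2 := LinearMap.finrank_range_add_finrank_ker B.mulVecLin
  rw [h] at h1
  unfold Matrix.rank
  omega

variable {V : Type*} [Fintype V] [DecidableEq V] {A J B : Matrix V V ℝ}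

theorem IsEigenprojection.unique {Z : Matrix V V ℝ} (hJ : IsEigenprojection A J)
    (hZ : IsEigenprojection A Z) : Z = J := by
  refine Matrix.toLin'.injective (LinearMap.ext fun x => ?_)
  simp only [Matrix.toLin'_apply]
  have h1 : Z *ᵥ (J *ᵥ x) = J *ᵥ x := by
    have : J *ᵥ x ∈ LinearMap.range Z.mulVecLin := by
      rw [hZ.range_eq, ← hJ.range_eq]
      exact ⟨x, rfl⟩
    obtain ⟨y, hy⟩ := this
    rw [Matrix.mulVecLin_apply] at hy
    rw [← hy, Matrix.mulVec_mulVec, ← sq, hZ.idempotent]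
  have h2 : Z *ᵥ (x - J *ᵥ x) = 0 := by
    have : x - J *ᵥ x ∈ LinearMap.ker Z.mulVecLin := by
      rw [hZ.ker_eq, ← hJ.ker_eq, LinearMap.mem_ker, Matrix.mulVecLin_apply, Matrix.mulVec_sub,
        Matrix.mulVec_mulVec, ← sq, hJ.idempotent, sub_self]
    exact this
  rw [Matrix.mulVec_sub, h1, sub_eq_zero] at h2
  exact h2

theorem sq_eq_self_of_mul_eq_zero (hJA : J * A = 0) (hB : J = 1 - A * B) : J ^ 2 = J := by
  calc J ^ 2 = J * (1 - A * B) := by rw [sq, ← hB]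
    _ = J := by rw [mul_sub, mul_one, ← mul_assoc, hJA, zero_mul, sub_zero]

theorem range_mulVecLin_eq_ker (hAJ : A * J = 0) (hB : J = 1 - B * A) :
    LinearMap.range J.mulVecLin = LinearMap.ker A.mulVecLin := by
  ext x
  simp only [LinearMap.mem_range, LinearMap.mem_ker, Matrix.mulVecLin_apply]
  constructor
  · rintro ⟨y, rfl⟩
    rw [Matrix.mulVec_mulVec, hAJ, Matrix.zero_mulVec]
  · intro hx
    exact ⟨x, by rw [hB, Matrix.sub_mulVec, ← Matrix.mulVec_mulVec, hx]; simp⟩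

theorem range_vecMulLinear_eq_ker (hJA : J * A = 0) (hB : J = 1 - A * B) :
    LinearMap.range J.vecMulLinear = LinearMap.ker A.vecMulLinear := by
  ext x
  simp only [LinearMap.mem_range, LinearMap.mem_ker, Matrix.vecMulLinear_apply]
  constructor
  · rintro ⟨y, rfl⟩
    rw [Matrix.vecMul_vecMul, hJA, Matrix.vecMul_zero]
  · intro hx
    exact ⟨x, by rw [hB, Matrix.vecMul_sub, ← Matrix.vecMul_vecMul, hx]; simp⟩

theorem ker_mulVecLin_eq_range (hJA : J * A = 0) (hB : J = 1 - A * B) :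
    LinearMap.ker J.mulVecLin = LinearMap.range A.mulVecLin := by
  ext x
  simp only [LinearMap.mem_range, LinearMap.mem_ker, Matrix.mulVecLin_apply]
  constructor
  · intro hx
    refine ⟨B *ᵥ x, ?_⟩
    rw [hB, Matrix.sub_mulVec, Matrix.one_mulVec, sub_eq_zero, ← Matrix.mulVec_mulVec] at hx
    exact hx.symm
  · rintro ⟨y, rfl⟩
    rw [Matrix.mulVec_mulVec, hJA, Matrix.zero_mulVec]

/-- The index is at most `1`: if `A²x = 0`, then `Ax` lies in the kernel of `A`, where `J = 1 - BA`
acts as the identity, while `JA = 0`; so `Ax = 0`. -/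
theorem isEigenprojection_of_mul_eq_zero (hAJ : A * J = 0) (hJA : J * A = 0)
    (hB : J = 1 - A * B) (hB' : J = 1 - B * A) : IsEigenprojection A J := by
  have hmem : (1 : ℕ) ∈ {k | (A ^ (k + 1)).rank = (A ^ k).rank} := by
    refine rank_eq_rank_of_ker_eq ?_
    ext x
    simp only [LinearMap.mem_ker, Matrix.mulVecLin_apply, pow_one]
    constructor
    · intro hx
      rw [sq, ← Matrix.mulVec_mulVec] at hx
      have : J *ᵥ (A *ᵥ x) = A *ᵥ x := by
        rw [hB', Matrix.sub_mulVec, ← Matrix.mulVec_mulVec, hx]; simp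
      rw [← this, Matrix.mulVec_mulVec, hJA, Matrix.zero_mulVec]
    · intro hx
      rw [sq, ← Matrix.mulVec_mulVec, hx, Matrix.mulVec_zero]
  have hν := Nat.sInf_mem ⟨1, hmem⟩
  have hle : matrixIndex A ≤ 1 := Nat.sInf_le hmem
  have hidem := sq_eq_self_of_mul_eq_zero hJA hB
  have hcases : matrixIndex A = 0 ∨ matrixIndex A = 1 := by omega
  rcases hcases with h0 | h1
  -- Index `0` means that `A` is invertible. Then `J = 0`, which matches the power `A ^ 0 = 1`.
  · change (A ^ (matrixIndex A + 1)).rank = (A ^ matrixIndex A).rank at hν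
    rw [h0, zero_add, pow_one, pow_zero, Matrix.rank_one] at hν
    have hker : LinearMap.ker A.mulVecLin = ⊥ := by
      have h := LinearMap.finrank_range_add_finrank_ker A.mulVecLin
      unfold Matrix.rank at hν
      rw [Module.finrank_fintype_fun_eq_card] at h
      exact Submodule.finrank_eq_zero.1 (by omega)
    have hJ : J = 0 := by
      have h := range_mulVecLin_eq_ker hAJ hB'
      rw [hker, LinearMap.range_eq_bot] at h
      refine Matrix.toLin'.injective ?_
      rw [map_zero]
      exact h
    refine ⟨hidem, ?_, ?_⟩ <;> rw [h0, hJ] <;> simp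
  · refine ⟨hidem, ?_, ?_⟩ <;> rw [h1, pow_one]
    · exact range_mulVecLin_eq_ker hAJ hB'
    · exact ker_mulVecLin_eq_range hJA hB

theorem rank_eq_trace_of_sq_eq_self (h : J ^ 2 = J) : (J.rank : ℝ) = J.trace := by
  have hp : LinearMap.IsProj (LinearMap.range J.mulVecLin) J.mulVecLin := by
    refine ⟨fun x => ⟨x, rfl⟩, ?_⟩
    rintro _ ⟨y, rfl⟩
    simp only [Matrix.mulVecLin_apply]
    rw [Matrix.mulVec_mulVec, ← sq, h]
  have := hp.trace
  rw [← Matrix.toLin'_apply', Matrix.trace_toLin'_eq] at this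
  rw [Matrix.rank, this]
  rfl

end Eigenprojection

namespace ParentMap

variable {V : Type*} [Fintype V]

open Classical in
theorem sum_isForest_arcSet [DecidableEq V] {M : Type*} [AddCommMonoid M]
    (g : Finset (V × V) → M) :
    ∑ p : V → Option V with IsForest p, g (arcSet p) = ∑ F with IsDivergingForest F, g F := by
  refine Finset.sum_nbij arcSet ?_ arcSet_injective.injOn ?_ fun _ _ => rfl
  · intro p hp
    simpa [isDivergingForest_arcSet_iff] using hp
  · intro F hF
    obtain ⟨p, hp, hpF⟩ := exists_isForest_of_isDivergingForest (Finset.mem_filter.1 hF).2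
    exact ⟨p, by simpa using hp, hpF⟩

end ParentMap

/-! ### Forests by number of arcs, and the normalized matrix -/

namespace WeightedDigraph

open Polynomial ParentMap

variable {V : Type*} [Fintype V]

/-- The weights of `Γ` multiplied by an indeterminate that counts arcs. -/
def polyWeight (Γ : WeightedDigraph V) (i j : V) : ℝ[X] :=
  X * C (Γ.a i j)

theorem weight_polyWeight (Γ : WeightedDigraph V) (p : V → Option V) :
    ParentMap.weight Γ.polyWeight p = C (Γ.weight (arcSet p)) * X ^ (arcSet p).card := by
  have h := prod_arcSet p fun e => Γ.polyWeight e.2 e.1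
  rw [ParentMap.weight, ← h]
  simp only [polyWeight, Finset.prod_mul_distrib, WeightedDigraph.weight, Finset.prod_const,
    map_prod]
  exact mul_comm _ _

open Classical in
/-- The total weight of the diverging forests with `k` arcs. -/
def forestTotal (Γ : WeightedDigraph V) (k : ℕ) : ℝ :=
  ∑ F with IsDivergingForest F ∧ F.card = k, Γ.weight F

open Classical in
/-- The matrix of diverging forests with `k` arcs. -/
def forestMatrix (Γ : WeightedDigraph V) (k : ℕ) : Matrix V V ℝ :=
  Matrix.of fun i j =>
    ∑ F with (IsDivergingForest F ∧ F.card = k) ∧ BelongsToTreeFrom F i j, Γ.weight F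

theorem coeff_totalWeight (Γ : WeightedDigraph V) (k : ℕ) :
    (totalWeight Γ.polyWeight).coeff k = Γ.forestTotal k := by
  classical
  rw [totalWeight, finsum_eq_sum_of_fintype, forestTotal, ← Finset.filter_filter,
    Finset.sum_filter (s := Finset.univ.filter fun F => IsDivergingForest F),
    ← sum_isForest_arcSet, Finset.sum_filter, finsetSum_coeff]
  refine Finset.sum_congr rfl fun p _ => ?_
  by_cases hp : IsForest p
  · simp [forestWeight, hp, weight_polyWeight, coeff_X_pow, eq_comm]
  · simp [forestWeight, hp]

theorem coeff_rootedWeight (Γ : WeightedDigraph V) (k : ℕ) (i j : V) :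
    (rootedWeight Γ.polyWeight i j).coeff k = Γ.forestMatrix k i j := by
  classical
  rw [rootedWeight, finsum_eq_sum_of_fintype, forestMatrix, Matrix.of_apply]
  simp only [and_assoc]
  rw [← Finset.filter_filter,
    Finset.sum_filter (s := Finset.univ.filter fun F => IsDivergingForest F),
    ← sum_isForest_arcSet, Finset.sum_filter, finsetSum_coeff]
  refine Finset.sum_congr rfl fun p _ => ?_
  by_cases hp : IsForest p
  · by_cases hr : IsRoot p i j
    · simp [forestWeight, hp, weight_polyWeight, coeff_X_pow, eq_comm, rootIndicator_of_isRoot hr,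
        hp.belongsToTreeFrom_iff, hr]
    · simp [forestWeight, hp, rootIndicator_of_not_isRoot hr, hp.belongsToTreeFrom_iff, hr]
  · simp [forestWeight, hp]

/-- The term `l = i` vanishes, so loop weights play no role. -/
theorem kirchhoff_mul_apply (Γ : WeightedDigraph V) (M : Matrix V V ℝ) (i j : V) :
    (Γ.kirchhoff * M) i j = ∑ l, Γ.a i l * (M i j - M l j) := by
  classical
  rw [Matrix.mul_apply, ← Finset.add_sum_erase _ _ (Finset.mem_univ i),
    ← Finset.add_sum_erase _ (fun l => Γ.a i l * (M i j - M l j)) (Finset.mem_univ i)]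
  have h1 : Γ.kirchhoff i i = ∑ l ∈ Finset.univ.erase i, Γ.a i l := by
    simp [kirchhoff, Finset.filter_ne']
  have h2 : ∀ l ∈ Finset.univ.erase i, Γ.kirchhoff i l * M l j = -(Γ.a i l * M l j) := by
    intro l hl
    simp [kirchhoff, Finset.ne_of_mem_erase hl]
  rw [h1, Finset.sum_congr rfl h2, sub_self, mul_zero, zero_add, Finset.sum_mul,
    ← Finset.sum_add_distrib]
  exact Finset.sum_congr rfl fun l _ => by ring

/-- The factor `X` in each weight shifts the degree by one. -/
theorem coeff_sum_polyWeight (Γ : WeightedDigraph V) (k : ℕ) (i j : V) :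
    (∑ l, Γ.polyWeight i l * (rootedWeight Γ.polyWeight i j - rootedWeight Γ.polyWeight l j)).coeff
      (k + 1) = (Γ.kirchhoff * Γ.forestMatrix k) i j := by
  rw [kirchhoff_mul_apply, finsetSum_coeff]
  refine Finset.sum_congr rfl fun l _ => ?_
  rw [polyWeight, mul_assoc, coeff_X_mul, coeff_C_mul, coeff_sub, coeff_rootedWeight,
    coeff_rootedWeight]

/-- A product of weights is nonzero exactly when all its arcs are present, so sums over the
out-forests of `Γ` may run over all diverging forests on `V`. -/
theorem mem_outForests (Γ : WeightedDigraph V) {F : Finset (V × V)} :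
    F ∈ Γ.outForests ↔ IsDivergingForest F ∧ Γ.weight F ≠ 0 := by
  classical
  rw [outForests, Finset.mem_filter, Finset.mem_powerset, and_comm, weight, Finset.prod_ne_zero_iff]
  refine and_congr_right fun _ => ?_
  simp [Finset.subset_iff, arcs]

theorem maxOutForests_nonempty (Γ : WeightedDigraph V) : Γ.maxOutForests.Nonempty := by
  classical
  have h0 : (∅ : Finset (V × V)) ∈ Γ.outForests := by
    rw [mem_outForests]
    refine ⟨?_, by simp [weight]⟩
    have h : arcSet (fun _ : V => none) = ∅ := by simp [arcSet]
    rw [← h, isDivergingForest_arcSet_iff]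
    exact fun v => ⟨v, .refl, rfl⟩
  obtain ⟨F, hF, hmax⟩ := Finset.exists_max_image Γ.outForests Finset.card ⟨_, h0⟩
  exact ⟨F, Finset.mem_filter.2 ⟨hF, hmax⟩⟩

theorem mem_maxOutForests_iff (Γ : WeightedDigraph V) {F F₀ : Finset (V × V)}
    (h₀ : F₀ ∈ Γ.maxOutForests) :
    F ∈ Γ.maxOutForests ↔ (IsDivergingForest F ∧ F.card = F₀.card) ∧ Γ.weight F ≠ 0 := by
  classical
  rw [maxOutForests, Finset.mem_filter] at h₀ ⊢
  constructor
  · rintro ⟨h, hmax⟩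
    exact ⟨⟨(Γ.mem_outForests.1 h).1, le_antisymm (h₀.2 _ h) (hmax _ h₀.1)⟩,
      (Γ.mem_outForests.1 h).2⟩
  · rintro ⟨⟨h, hc⟩, hw⟩
    exact ⟨Γ.mem_outForests.2 ⟨h, hw⟩, hc ▸ h₀.2⟩

theorem forestTotal_card (Γ : WeightedDigraph V) {F₀ : Finset (V × V)}
    (h₀ : F₀ ∈ Γ.maxOutForests) : Γ.forestTotal F₀.card = ∑ F ∈ Γ.maxOutForests, Γ.weight F := by
  classical
  rw [forestTotal, ← Finset.sum_filter_ne_zero]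
  refine Finset.sum_congr ?_ fun _ _ => rfl
  ext F
  simp [Γ.mem_maxOutForests_iff h₀]

theorem sum_weight_maxOutForests_pos (Γ : WeightedDigraph V) :
    0 < ∑ F ∈ Γ.maxOutForests, Γ.weight F := by
  obtain ⟨F₀, h₀⟩ := Γ.maxOutForests_nonempty
  exact Finset.sum_pos (fun F hF => lt_of_le_of_ne (Finset.prod_nonneg fun _ _ => Γ.nonneg _ _)
    ((Γ.mem_maxOutForests_iff h₀).1 hF).2.symm) ⟨F₀, h₀⟩

theorem normMaxForestMatrix_eq (Γ : WeightedDigraph V) {F₀ : Finset (V × V)}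
    (h₀ : F₀ ∈ Γ.maxOutForests) :
    Γ.normMaxForestMatrix = (Γ.forestTotal F₀.card)⁻¹ • Γ.forestMatrix F₀.card := by
  classical
  ext i j
  rw [normMaxForestMatrix, Matrix.of_apply, Matrix.smul_apply, smul_eq_mul, div_eq_inv_mul,
    forestTotal_card Γ h₀, forestMatrix, Matrix.of_apply]
  congr 1
  rw [← Finset.sum_filter_ne_zero
    (s := Finset.univ.filter fun F => (IsDivergingForest F ∧ F.card = F₀.card) ∧ _)]
  refine Finset.sum_congr ?_ fun _ _ => rfl
  ext F
  simp [Γ.mem_maxOutForests_iff h₀, and_right_comm]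

theorem weight_eq_zero_of_card_lt (Γ : WeightedDigraph V) {F₀ F : Finset (V × V)}
    (h₀ : F₀ ∈ Γ.maxOutForests) (hF : IsDivergingForest F) (h : F₀.card < F.card) :
    Γ.weight F = 0 := by
  classical
  by_contra hw
  exact absurd ((Finset.mem_filter.1 h₀).2 F (Γ.mem_outForests.2 ⟨hF, hw⟩)) (by omega)

open Classical in
theorem numWeakComponents_add_card {F : Finset (V × V)} (hF : IsDivergingForest F) :
    numWeakComponents F + F.card = Fintype.card V := by
  obtain ⟨p, hp, rfl⟩ := exists_isForest_of_isDivergingForest hF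
  rw [hp.numWeakComponents_eq, add_comm, card_arcSet_add_card_roots]

open Classical in
theorem card_belongsToTreeFrom_self {F : Finset (V × V)} (hF : IsDivergingForest F) :
    (Finset.univ.filter fun v => BelongsToTreeFrom F v v).card = numWeakComponents F := by
  obtain ⟨p, hp, rfl⟩ := exists_isForest_of_isDivergingForest hF
  rw [hp.numWeakComponents_eq]
  congr 1
  ext v
  simpa [hp.belongsToTreeFrom_iff] using ⟨fun h => h.2, fun h => (isRoot_self h).2 rfl⟩

/-- Components and arcs of a forest add up to the number of vertices, so most arcs means fewest
components. -/
theorem outForestDim_eq (Γ : WeightedDigraph V) {F₀ : Finset (V × V)}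
    (h₀ : F₀ ∈ Γ.maxOutForests) : Γ.outForestDim = numWeakComponents F₀ := by
  classical
  have h := Finset.mem_filter.1 h₀
  refine le_antisymm (Nat.sInf_le ⟨F₀, h.1, rfl⟩) (le_csInf ⟨_, F₀, h.1, rfl⟩ ?_)
  rintro _ ⟨F, hF, rfl⟩
  have h1 := numWeakComponents_add_card (Γ.mem_outForests.1 hF).1
  have h2 := numWeakComponents_add_card (Γ.mem_outForests.1 h.1).1
  have h3 := h.2 F hF
  omega

theorem trace_normMaxForestMatrix (Γ : WeightedDigraph V) :
    Γ.normMaxForestMatrix.trace = Γ.outForestDim := by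
  classical
  have h : ∀ F ∈ Γ.maxOutForests,
      ((Finset.univ.filter fun v => BelongsToTreeFrom F v v).card : ℝ) = Γ.outForestDim := by
    intro F hF
    rw [card_belongsToTreeFrom_self ((Γ.mem_maxOutForests_iff hF).1 hF).1.1, Γ.outForestDim_eq hF]
  simp only [Matrix.trace, Matrix.diag_apply, normMaxForestMatrix, Matrix.of_apply]
  rw [← Finset.sum_div, div_eq_iff Γ.sum_weight_maxOutForests_pos.ne']
  simp only [Finset.sum_filter]
  rw [Finset.sum_comm, Finset.mul_sum]
  refine Finset.sum_congr rfl fun F hF => ?_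
  rw [← h F hF, ← Finset.sum_filter, Finset.sum_const, nsmul_eq_mul]

variable [DecidableEq V]

theorem forestMatrix_zero (Γ : WeightedDigraph V) :
    Γ.forestMatrix 0 = Γ.forestTotal 0 • (1 : Matrix V V ℝ) := by
  ext i j
  have h := congrArg (coeff · 0) (rootedWeight_add_sum Γ.polyWeight i j)
  simp only [coeff_add, finsetSum_coeff, polyWeight, mul_assoc, coeff_X_mul_zero,
    Finset.sum_const_zero, add_zero] at h
  rw [← coeff_rootedWeight, ← coeff_totalWeight, Matrix.smul_apply, Matrix.one_apply]
  refine h.trans ?_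
  split_ifs <;> simp

/-- The recurrence for the matrices of forests. -/
theorem forestMatrix_succ (Γ : WeightedDigraph V) (k : ℕ) :
    Γ.forestMatrix (k + 1) =
      Γ.forestTotal (k + 1) • (1 : Matrix V V ℝ) - Γ.kirchhoff * Γ.forestMatrix k := by
  rw [eq_sub_iff_add_eq]
  ext i j
  have h := congrArg (coeff · (k + 1)) (rootedWeight_add_sum Γ.polyWeight i j)
  simp only [coeff_add, coeff_sum_polyWeight, coeff_rootedWeight] at h
  rw [← coeff_totalWeight, Matrix.smul_apply, Matrix.one_apply, Matrix.add_apply]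
  refine h.trans ?_
  split_ifs <;> simp

theorem commute_forestMatrix (Γ : WeightedDigraph V) (k : ℕ) :
    Commute Γ.kirchhoff (Γ.forestMatrix k) := by
  induction k with
  | zero =>
    rw [forestMatrix_zero]
    exact (Commute.one_right _).smul_right _
  | succ k ih =>
    rw [forestMatrix_succ]
    exact ((Commute.one_right _).smul_right _).sub_right ((Commute.refl _).mul_right ih)

/-- The recurrence one step beyond the maximum, where both forest terms vanish. -/
theorem kirchhoff_mul_forestMatrix_card (Γ : WeightedDigraph V) {F₀ : Finset (V × V)}
    (h₀ : F₀ ∈ Γ.maxOutForests) : Γ.kirchhoff * Γ.forestMatrix F₀.card = 0 := by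
  classical
  have h1 : Γ.forestTotal (F₀.card + 1) = 0 :=
    Finset.sum_eq_zero fun F hF =>
      Γ.weight_eq_zero_of_card_lt h₀ (Finset.mem_filter.1 hF).2.1 (by
        rw [(Finset.mem_filter.1 hF).2.2]; omega)
  have h2 : Γ.forestMatrix (F₀.card + 1) = 0 := by
    ext i j
    exact Finset.sum_eq_zero fun F hF =>
      Γ.weight_eq_zero_of_card_lt h₀ (Finset.mem_filter.1 hF).2.1.1 (by
        rw [(Finset.mem_filter.1 hF).2.1.2]; omega)
  have h := Γ.forestMatrix_succ F₀.card
  rw [h1, h2, zero_smul, zero_sub, eq_comm, neg_eq_zero] at h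
  exact h

theorem kirchhoff_mul_normMaxForestMatrix (Γ : WeightedDigraph V) :
    Γ.kirchhoff * Γ.normMaxForestMatrix = 0 := by
  obtain ⟨F₀, h₀⟩ := Γ.maxOutForests_nonempty
  rw [Γ.normMaxForestMatrix_eq h₀, Matrix.mul_smul, Γ.kirchhoff_mul_forestMatrix_card h₀, smul_zero]

theorem normMaxForestMatrix_mul_kirchhoff (Γ : WeightedDigraph V) :
    Γ.normMaxForestMatrix * Γ.kirchhoff = 0 := by
  obtain ⟨F₀, h₀⟩ := Γ.maxOutForests_nonempty
  rw [Γ.normMaxForestMatrix_eq h₀, Matrix.smul_mul, ← (Γ.commute_forestMatrix _).eq,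
    Γ.kirchhoff_mul_forestMatrix_card h₀, smul_zero]

theorem exists_normMaxForestMatrix_eq_one_sub (Γ : WeightedDigraph V) :
    ∃ B : Matrix V V ℝ, Commute Γ.kirchhoff B ∧ Γ.normMaxForestMatrix = 1 - Γ.kirchhoff * B := by
  obtain ⟨F₀, h₀⟩ := Γ.maxOutForests_nonempty
  have hσ : Γ.forestTotal F₀.card ≠ 0 := by
    rw [Γ.forestTotal_card h₀]
    exact Γ.sum_weight_maxOutForests_pos.ne'
  rw [Γ.normMaxForestMatrix_eq h₀]
  rcases h : F₀.card with - | k <;> rw [h] at hσ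
  -- Maximum out-forests without arcs have no preceding forest matrix; here the normalized matrix is
  -- the identity.
  · exact ⟨0, Commute.zero_right _, by simp [forestMatrix_zero, smul_smul, hσ]⟩
  · refine ⟨(Γ.forestTotal (k + 1))⁻¹ • Γ.forestMatrix k,
      (Γ.commute_forestMatrix k).smul_right _, ?_⟩
    rw [forestMatrix_succ, smul_sub, smul_smul, inv_mul_cancel₀ hσ, one_smul, Matrix.mul_smul]

end WeightedDigraph

end

theorem proposition6 {V : Type*} [Fintype V] [DecidableEq V] (Γ : WeightedDigraph V) :
    Γ.normMaxForestMatrix.rank = Γ.outForestDim ∧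
    Γ.normMaxForestMatrix ^ 2 = Γ.normMaxForestMatrix ∧
    Γ.kirchhoff * Γ.normMaxForestMatrix = 0 ∧
    Γ.normMaxForestMatrix * Γ.kirchhoff = 0 ∧
    (IsEigenprojection Γ.kirchhoff Γ.normMaxForestMatrix ∧
      ∀ Z : Matrix V V ℝ, IsEigenprojection Γ.kirchhoff Z → Z = Γ.normMaxForestMatrix) ∧
    Submodule.span ℝ (Set.range Γ.normMaxForestMatrix.col) =
      LinearMap.ker Γ.kirchhoff.mulVecLin ∧
    Submodule.span ℝ (Set.range Γ.normMaxForestMatrix.row) =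
      LinearMap.ker Γ.kirchhoff.vecMulLinear := by
  have hLJ := Γ.kirchhoff_mul_normMaxForestMatrix
  have hJL := Γ.normMaxForestMatrix_mul_kirchhoff
  obtain ⟨B, hcomm, hB⟩ := Γ.exists_normMaxForestMatrix_eq_one_sub
  have hB' := hB
  rw [hcomm.eq] at hB'
  have hsq := sq_eq_self_of_mul_eq_zero hJL hB
  have hE := isEigenprojection_of_mul_eq_zero hLJ hJL hB hB'
  refine ⟨?_, hsq, hLJ, hJL, ⟨hE, fun Z hZ => hE.unique hZ⟩, ?_, ?_⟩
  · have h := rank_eq_trace_of_sq_eq_self hsq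
    rw [Γ.trace_normMaxForestMatrix] at h
    exact_mod_cast h
  · rw [← Matrix.range_mulVecLin, range_mulVecLin_eq_ker hLJ hB']
  · rw [← range_vecMulLinear, range_vecMulLinear_eq_ker hJL hB]
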